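/- Let $X$ be an $n$-dimensional real or complex inner product space (the inner product conjugate-linear in its first argument), and let $\bigwedge X$ be its exterior algebra with the inner product for which $\langle v_1\wedge\dots\wedge v_p, w_1\wedge\dots\wedge w_p\rangle=\det(\langle v_i,w_j\rangle)$, $\langle\lambda,\mu\rangle=\overline{\lambda}\mu$ for scalars, and elements of distinct grades are orthogonal. Fix an orientation, i.e. an element $\Omega\in\bigwedge^n X$ with $\|\Omega\|=1$. For $M\in\bigwedge X$ let the dual $M^\star\in\bigwedge X$ be the unique element with $\langle L, M^\star\rangle=\langle M\wedge L,\Omega\rangle$ for all $L\in\bigwedge X$; the map $M\mapsto M^\star$ is bijective, and the regressive product $M\vee N$ is defined by $(M\vee N)^\star=M^\star\wedge N^\star$. A blade is a scalar or a product $v_1\wedge\dots\wedge v_p$ of vectors of $X$. Its space is $[B]=\operatorname{span}(v_1,\dots,v_p)$ if $0\neq B=v_1\wedge\dots\wedge v_p$, and $[B]=\{0\}$ if $B$ is a scalar (including $B=0$). For subspaces $V,W\subset X$ of dimensions $p,q$, with $m=\min\{p,q\}$, associated principal bases are orthonormal bases $(e_1,\dots,e_p)$ of $V$ and $(f_1,\dots,f_q)$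 of $W$ such that $\langle e_i,f_j\rangle=0$ for $i\neq j$ and $\langle e_i,f_i\rangle=\cos\theta_i$ for $1\le i\le m$, with $0\le\theta_1\le\dots\le\theta_m\le\frac{\pi}{2}$. The asymmetric angle of $V$ with $W$ is $$\Theta_{V,W}=\cos^{-1}\frac{|\langle C,D_P\rangle|}{\|C\|\,\|D\|}\in\left[0,\tfrac{\pi}{2}\right],$$ where $C,D$ are nonzero blades with $[C]=V$ and $[D]=W$, and $D=D_P\wedge D_\perp$ with $D_P=\epsilon\|D\|\,f_1\wedge\dots\wedge f_m$, $D_\perp=f_{m+1}\wedge\dots\wedge f_q$, $|\epsilon|=1$, for associated principal bases as above (empty products are $1$); it does not depend on the choices. Then, for all blades $A,B\in\bigwedge X$, $$\|A\vee B\|=\|A\|\,\|B\|\,\cos\Theta_{[A]^\perp,[B]}.$$ -/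

import Mathlib

noncomputable section

namespace Grassmann

open ExteriorAlgebra

variable {𝕜 : Type*} [RCLike 𝕜] {X : Type*} [NormedAddCommGroup X] [InnerProductSpace 𝕜 X]

/-- For fixed `v₁, …, v_p`, the alternating map `(w₁, …, w_k) ↦ det ⟪v_i, w_j⟫` if `k = p`, and `0` if
`k ≠ p`. -/
def gramAlternating {p : ℕ} (v : Fin p → X) (k : ℕ) : X [⋀^Fin k]→ₗ[𝕜] 𝕜 :=
  if h : k = p then
    Matrix.detRowAlternating.compLinearMap
      (LinearMap.pi fun i : Fin k => innerₛₗ 𝕜 (v (Fin.cast h i)))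
  else 0

/-- The linear functional `N ↦ ⟪v₁ ∧ ⋯ ∧ v_p, N⟫` on the exterior algebra. -/
def gramFunctional {p : ℕ} (v : Fin p → X) : ExteriorAlgebra 𝕜 X →ₗ[𝕜] 𝕜 :=
  liftAlternating (gramAlternating v)

theorem gramFunctional_ιMulti_same {p : ℕ} (v w : Fin p → X) :
    gramFunctional v (ιMulti 𝕜 p w) = Matrix.det (Matrix.of fun i j => inner 𝕜 (v i) (w j)) := by
  rw [gramFunctional, liftAlternating_apply_ιMulti, gramAlternating, dif_pos rfl,
    ← Matrix.det_transpose]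
  rfl

theorem gramFunctional_ιMulti_ne {p q : ℕ} (h : p ≠ q) (v : Fin p → X) (w : Fin q → X) :
    gramFunctional v (ιMulti 𝕜 q w) = 0 := by
  rw [gramFunctional, liftAlternating_apply_ιMulti, gramAlternating, dif_neg (Ne.symm h)]
  rfl

theorem gram_update {p : ℕ} (v w : Fin p → X) (i : Fin p) (x : X) :
    (Matrix.of fun a b => inner 𝕜 (Function.update v i x a) (w b)) =
      (Matrix.of fun a b => inner 𝕜 (v a) (w b)).updateRow i (fun b => inner 𝕜 x (w b)) := by
  ext a b
  by_cases h : a = i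
  · subst h; simp
  · simp [h]

/-- The map `(w₁, …, w_p) ↦ (M ↦ ⟪M, w₁ ∧ ⋯ ∧ w_p⟫)`, which is alternating in the `w_i` and
conjugate-linear in `M`. -/
def conjGram (p : ℕ) :
    X [⋀^Fin p]→ₗ[𝕜] (ExteriorAlgebra 𝕜 X →ₛₗ[starRingEnd 𝕜] 𝕜) :=
  { toFun := fun v => (starLinearEquiv 𝕜 : 𝕜 ≃ₗ⋆[𝕜] 𝕜).toLinearMap.comp (gramFunctional v)
    map_update_add' := by
      intro inst v i x y
      obtain rfl : inst = instDecidableEqFin p := Subsingleton.elim _ _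
      have h : gramFunctional (𝕜 := 𝕜) (Function.update v i (x + y)) =
          gramFunctional (Function.update v i x) + gramFunctional (Function.update v i y) := by
        ext q w
        simp only [LinearMap.compAlternatingMap_apply, LinearMap.add_apply]
        by_cases hq : p = q
        · subst hq
          simp only [gramFunctional_ιMulti_same]
          rw [gram_update, gram_update, gram_update, ← Matrix.det_updateRow_add]
          congr 2
          ext b
          simp [inner_add_left]
        · simp [gramFunctional_ιMulti_ne hq]
      ext N
      simp [h]
    map_update_smul' := by
      intro inst v i c x
      obtain rfl : inst = instDecidableEqFin p := Subsingleton.elim _ _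
      have h : gramFunctional (𝕜 := 𝕜) (Function.update v i (c • x)) =
          star c • gramFunctional (Function.update v i x) := by
        ext q w
        simp only [LinearMap.compAlternatingMap_apply, LinearMap.smul_apply]
        by_cases hq : p = q
        · subst hq
          simp only [gramFunctional_ιMulti_same]
          rw [gram_update, gram_update, smul_eq_mul, ← Matrix.det_updateRow_smul]
          congr 2
          ext b
          simp [inner_smul_left]
        · simp [gramFunctional_ιMulti_ne hq]
      ext N
      simp [h]
    map_eq_zero_of_eq' := by
      intro v i j hv hij
      have h : gramFunctional (𝕜 := 𝕜) v = 0 := by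
        ext q w
        simp only [LinearMap.compAlternatingMap_apply, LinearMap.zero_apply]
        by_cases hq : p = q
        · subst hq
          simp only [gramFunctional_ιMulti_same]
          exact Matrix.det_zero_of_row_eq hij (by ext b; simp [hv])
        · simp [gramFunctional_ιMulti_ne hq]
      ext N
      simp [h] }

/-- The inner product of the exterior algebra with its arguments swapped: `innerForm N M = ⟪M, N⟫`. -/
def innerForm : ExteriorAlgebra 𝕜 X →ₗ[𝕜] (ExteriorAlgebra 𝕜 X →ₛₗ[starRingEnd 𝕜] 𝕜) :=
  liftAlternating conjGram

theorem innerForm_same {p : ℕ} (v w : Fin p → X) :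
    innerForm (ιMulti 𝕜 p w) (ιMulti 𝕜 p v) =
      Matrix.det (Matrix.of fun i j => inner 𝕜 (v i) (w j)) := by
  rw [innerForm, liftAlternating_apply_ιMulti]
  change star (gramFunctional w (ιMulti 𝕜 p v)) = _
  rw [gramFunctional_ιMulti_same, ← Matrix.det_conjTranspose]
  congr 1
  ext i j
  simp [Matrix.conjTranspose_apply]

theorem innerForm_ne {p q : ℕ} (h : p ≠ q) (v : Fin p → X) (w : Fin q → X) :
    innerForm (ιMulti 𝕜 q w) (ιMulti 𝕜 p v) = 0 := by
  rw [innerForm, liftAlternating_apply_ιMulti]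
  change star (gramFunctional w (ιMulti 𝕜 p v)) = _
  rw [gramFunctional_ιMulti_ne h.symm, star_zero]

theorem innerForm_basis {I : Type*} [Fintype I] [LinearOrder I] (b : OrthonormalBasis I 𝕜 X)
    (s t : Finset I) :
    innerForm (b.toBasis.ExteriorAlgebra t) (b.toBasis.ExteriorAlgebra s) =
      if s = t then (1 : 𝕜) else 0 := by
  by_cases hc : s.card = t.card
  · rw [ExteriorAlgebra.basis_apply_ofCard b.toBasis (rfl : s.card = s.card),
      ExteriorAlgebra.basis_apply_ofCard b.toBasis hc.symm, innerForm_same]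
    split_ifs with h
    · subst h
      rw [← Matrix.det_one (n := Fin s.card)]
      congr 1
      ext i j
      simp [Matrix.one_apply, orthonormal_iff_ite.mp b.orthonormal]
    · have h' : Set.powersetCard.ofCard (rfl : s.card = s.card) ≠
          Set.powersetCard.ofCard hc.symm := fun e => h (congrArg Subtype.val e)
      obtain ⟨x, hxs, hxt⟩ := (Set.powersetCard.exists_mem_notMem_iff_ne _ _).mp h'
      simp only [Set.mem_range, not_exists,
        ← Set.powersetCard.mem_range_ofFinEmbEquiv_symm_iff_mem] at hxs hxt
      obtain ⟨i, rfl⟩ := hxs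
      refine Matrix.det_eq_zero_of_row_eq_zero i fun j => ?_
      simpa using b.orthonormal.inner_eq_zero fun e => hxt j e.symm
  · rw [ExteriorAlgebra.basis_apply, ExteriorAlgebra.basis_apply, innerForm_ne hc,
      if_neg fun e => hc (by rw [e])]

theorem innerForm_eq_sum {I : Type*} [Fintype I] [LinearOrder I] (b : OrthonormalBasis I 𝕜 X)
    (M N : ExteriorAlgebra 𝕜 X) :
    innerForm N M = ∑ s, b.toBasis.ExteriorAlgebra.repr N s *
      star (b.toBasis.ExteriorAlgebra.repr M s) := by
  conv_lhs =>
    rw [← b.toBasis.ExteriorAlgebra.sum_repr M, ← b.toBasis.ExteriorAlgebra.sum_repr N]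
  simp only [map_sum, LinearMap.sum_apply, map_smul, LinearMap.smul_apply, LinearMap.map_smulₛₗ,
    innerForm_basis]
  simp [mul_comm]

instance [FiniteDimensional 𝕜 X] : FiniteDimensional 𝕜 (ExteriorAlgebra 𝕜 X) :=
  Module.Basis.finiteDimensional_of_finite
    (stdOrthonormalBasis 𝕜 X).toBasis.ExteriorAlgebra

variable (𝕜 X) in
/-- The inner product of the exterior algebra: conjugate-linear in the first argument, given by the
Gram determinant on blades of equal grade, and with blades of distinct grades orthogonal. -/
abbrev innerCore [FiniteDimensional 𝕜 X] :
    InnerProductSpace.Core 𝕜 (ExteriorAlgebra 𝕜 X) where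
  inner M N := innerForm N M
  conj_inner_symm M N := by
    simp only [innerForm_eq_sum (stdOrthonormalBasis 𝕜 X), map_sum, map_mul]
    exact Finset.sum_congr rfl fun s _ => by simp [mul_comm]
  add_left M M' N := by simp
  smul_left M N c := by simp
  re_inner_nonneg M := by
    rw [innerForm_eq_sum (stdOrthonormalBasis 𝕜 X), map_sum]
    refine Finset.sum_nonneg fun s _ => ?_
    rw [RCLike.star_def, RCLike.mul_conj]
    norm_cast
    positivity
  definite M h := by
    rw [innerForm_eq_sum (stdOrthonormalBasis 𝕜 X)] at h
    simp only [RCLike.star_def, RCLike.mul_conj] at h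
    norm_cast at h
    rw [Finset.sum_eq_zero_iff_of_nonneg (fun _ _ => by positivity)] at h
    apply (stdOrthonormalBasis 𝕜 X).toBasis.ExteriorAlgebra.ext_elem
    intro s
    simpa using h s (Finset.mem_univ s)

instance [FiniteDimensional 𝕜 X] : NormedAddCommGroup (ExteriorAlgebra 𝕜 X) :=
  (innerCore 𝕜 X).toNormedAddCommGroup

instance [FiniteDimensional 𝕜 X] : InnerProductSpace 𝕜 (ExteriorAlgebra 𝕜 X) :=
  InnerProductSpace.ofCore (innerCore 𝕜 X).toCore

variable [FiniteDimensional 𝕜 X]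

theorem inner_ιMulti {p : ℕ} (v w : Fin p → X) :
    inner 𝕜 (ιMulti 𝕜 p v) (ιMulti 𝕜 p w) =
      Matrix.det (Matrix.of fun i j => inner 𝕜 (v i) (w j)) :=
  innerForm_same v w

/-- The left contraction `M ⌟ N`, characterized by `⟪L, M ⌟ N⟫ = ⟪M ∧ L, N⟫` for all `L`. -/
def leftContraction (M N : ExteriorAlgebra 𝕜 X) : ExteriorAlgebra 𝕜 X :=
  LinearMap.adjoint (LinearMap.mulLeft 𝕜 M) N

theorem inner_leftContraction (L M N : ExteriorAlgebra 𝕜 X) :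
    inner 𝕜 L (leftContraction M N) = inner 𝕜 (M * L) N := by
  rw [leftContraction, LinearMap.adjoint_inner_right, LinearMap.mulLeft_apply]


theorem leftContraction_eq_iff (M N K : ExteriorAlgebra 𝕜 X) :
    leftContraction M N = K ↔ ∀ L, inner 𝕜 L K = inner 𝕜 (M * L) N := by
  refine ⟨fun h L => by rw [← h, inner_leftContraction], fun h => ?_⟩
  exact ext_inner_left 𝕜 fun L => by rw [inner_leftContraction, h]

/-- An orientation element: a unit `n`-vector, where `n = dim X`. -/
structure IsOrientation (Ω : ExteriorAlgebra 𝕜 X) : Prop where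
  mem : Ω ∈ ⋀[𝕜]^(Module.finrank 𝕜 X) X
  norm_eq_one : ‖Ω‖ = 1

/-- The right star (right dual) `M^⋆ = M ⌟ Ω`. -/
def rightStar (Ω M : ExteriorAlgebra 𝕜 X) : ExteriorAlgebra 𝕜 X :=
  leftContraction M Ω

theorem inner_basis_orientation {Ω : ExteriorAlgebra 𝕜 X} (hΩ : IsOrientation Ω)
    (s : Finset (Fin (Module.finrank 𝕜 X))) (hs : s ≠ Finset.univ) :
    inner 𝕜 ((stdOrthonormalBasis 𝕜 X).toBasis.ExteriorAlgebra s) Ω = 0 := by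
  have hc : s.card ≠ Module.finrank 𝕜 X := fun h =>
    hs ((Finset.card_eq_iff_eq_univ s).mp (by simpa using h))
  have h := hΩ.mem
  clear hΩ
  rw [← ExteriorAlgebra.ιMulti_span_fixedDegree] at h
  induction h using Submodule.span_induction with
  | mem x hx =>
    obtain ⟨w, rfl⟩ := hx
    rw [ExteriorAlgebra.basis_apply]
    exact innerForm_ne hc _ w
  | zero => simp
  | add x y _ _ hx hy => rw [inner_add_right, hx, hy, add_zero]
  | smul c x _ hx => rw [inner_smul_right, hx, mul_zero]

theorem inner_basis_univ_orientation {Ω : ExteriorAlgebra 𝕜 X} (hΩ : IsOrientation Ω) :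
    inner 𝕜 ((stdOrthonormalBasis 𝕜 X).toBasis.ExteriorAlgebra Finset.univ) Ω ≠ 0 := by
  intro h
  have h0 : Ω = 0 := by
    refine InnerProductSpace.ext_inner_left_basis (𝕜 := 𝕜)
      (stdOrthonormalBasis 𝕜 X).toBasis.ExteriorAlgebra fun s => ?_
    rw [inner_zero_right]
    by_cases hs : s = Finset.univ
    · rw [hs, h]
    · exact inner_basis_orientation hΩ s hs
  simpa [h0] using hΩ.norm_eq_one

theorem basis_mul_disjoint {I : Type*} [LinearOrder I] (b : Module.Basis I 𝕜 X)
    (s t : Finset I) (h : Disjoint s t) :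
    b.ExteriorAlgebra s * b.ExteriorAlgebra t = b.ExteriorAlgebra (s.disjUnion t h) ∨
      b.ExteriorAlgebra s * b.ExteriorAlgebra t = -b.ExteriorAlgebra (s.disjUnion t h) := by
  have h1 := ExteriorAlgebra.basis_mul_of_disjoint b (Set.powersetCard.ofCard (s := s) rfl)
    (Set.powersetCard.ofCard (s := t) rfl) h
  rcases Int.units_eq_one_or (Equiv.Perm.sign (Set.powersetCard.permOfDisjoint
    (s := Set.powersetCard.ofCard (s := s) rfl)
    (t := Set.powersetCard.ofCard (s := t) rfl) h)) with hσ | hσ <;> rw [hσ] at h1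
  · exact Or.inl (h1.trans (one_smul _ _))
  · exact Or.inr (h1.trans (by
      rw [Units.smul_def, Units.val_neg, Units.val_one, neg_smul, one_smul]
      rfl))

theorem eq_zero_of_inner_mul_orientation {Ω : ExteriorAlgebra 𝕜 X} (hΩ : IsOrientation Ω)
    (M : ExteriorAlgebra 𝕜 X) (h : ∀ L, inner 𝕜 Ω (M * L) = 0) : M = 0 := by
  set b := (stdOrthonormalBasis 𝕜 X).toBasis with hb
  refine b.ExteriorAlgebra.ext_elem fun s => ?_
  have key : ∀ t, t ≠ s → inner 𝕜 Ω (b.ExteriorAlgebra t * b.ExteriorAlgebra sᶜ) = 0 := by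
    intro t hts
    by_cases hd : Disjoint t sᶜ
    · have hne : t.disjUnion sᶜ hd ≠ Finset.univ := by
        intro e
        apply hts
        have h1 : t ⊆ s := disjoint_compl_right_iff.mp hd
        refine Finset.Subset.antisymm h1 fun x hx => ?_
        have := Finset.mem_univ x
        rw [← e, Finset.mem_disjUnion] at this
        simpa [hx] using this
      have hu : inner 𝕜 Ω (b.ExteriorAlgebra (t.disjUnion sᶜ hd)) = 0 := by
        rw [← inner_conj_symm, inner_basis_orientation hΩ _ hne, map_zero]
      rcases basis_mul_disjoint b t sᶜ hd with h1 | h1 <;> rw [h1]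
      · exact hu
      · rw [inner_neg_right, hu, neg_zero]
    · have := ExteriorAlgebra.basis_mul_of_not_disjoint b (Set.powersetCard.ofCard (s := t) rfl)
        (Set.powersetCard.ofCard (s := sᶜ) rfl) hd
      simp only [Set.powersetCard.val_ofCard] at this
      rw [this, inner_zero_right]
  have key' : inner 𝕜 Ω (b.ExteriorAlgebra s * b.ExteriorAlgebra sᶜ) ≠ 0 := by
    have hd : Disjoint s sᶜ := disjoint_compl_right
    have hu : inner 𝕜 Ω (b.ExteriorAlgebra (s.disjUnion sᶜ hd)) ≠ 0 := by
      rw [Finset.disjUnion_eq_union, Finset.union_compl, Ne, inner_eq_zero_symm]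
      exact inner_basis_univ_orientation hΩ
    rcases basis_mul_disjoint b s sᶜ hd with h1 | h1 <;> rw [h1] <;> simpa using hu
  have := h (b.ExteriorAlgebra sᶜ)
  rw [← b.ExteriorAlgebra.sum_repr M, Finset.sum_mul, inner_sum,
    Finset.sum_eq_single s] at this
  · rw [smul_mul_assoc, inner_smul_right] at this
    simpa [key'] using this
  · intro t _ hts
    rw [smul_mul_assoc, inner_smul_right, key t hts, mul_zero]
  · simp

theorem rightStar_bijective {Ω : ExteriorAlgebra 𝕜 X} (hΩ : IsOrientation Ω) :
    Function.Bijective (rightStar Ω) := by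
  let Φ : ExteriorAlgebra 𝕜 X →ₗ[𝕜] Module.Dual 𝕜 (ExteriorAlgebra 𝕜 X) :=
    (LinearMap.mul 𝕜 (ExteriorAlgebra 𝕜 X)).compr₂ (innerₛₗ 𝕜 Ω)
  have hΦ : ∀ M N, rightStar Ω M = N ↔ Φ M = innerₛₗ 𝕜 N := by
    intro M N
    rw [rightStar, leftContraction_eq_iff, LinearMap.ext_iff]
    refine forall_congr' fun L => ?_
    change _ ↔ inner 𝕜 Ω (M * L) = inner 𝕜 N L
    rw [← inner_conj_symm Ω, ← inner_conj_symm N, (starRingEnd 𝕜).injective.eq_iff, eq_comm]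
  have hinj : Function.Injective Φ := by
    rw [injective_iff_map_eq_zero]
    exact fun M hM => eq_zero_of_inner_mul_orientation hΩ M fun L => LinearMap.congr_fun hM L
  have hsurj : Function.Surjective Φ :=
    (LinearMap.injective_iff_surjective_of_finrank_eq_finrank
      (Subspace.dual_finrank_eq (K := 𝕜) (V := ExteriorAlgebra 𝕜 X)).symm).mp hinj
  refine ⟨fun M M' h => hinj ?_, fun N => ?_⟩
  · rw [(hΦ M _).mp rfl, (hΦ M' _).mp rfl, h]
  · obtain ⟨M, hM⟩ := hsurj (innerₛₗ 𝕜 N)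
    exact ⟨M, (hΦ M N).mpr hM⟩

/-- The regressive product `M ∨ N`, given by `(M ∨ N)^⋆ = M^⋆ ∧ N^⋆`. For an orientation `Ω` the star is
bijective, see `rightStar_bijective` and `regressive_eq_iff`. -/
def regressive (Ω M N : ExteriorAlgebra 𝕜 X) : ExteriorAlgebra 𝕜 X :=
  Function.invFun (rightStar Ω) (rightStar Ω M * rightStar Ω N)

theorem regressive_eq_iff {Ω : ExteriorAlgebra 𝕜 X} (hΩ : IsOrientation Ω)
    (M N R : ExteriorAlgebra 𝕜 X) :
    regressive Ω M N = R ↔ rightStar Ω R = rightStar Ω M * rightStar Ω N := by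
  have h : rightStar Ω (regressive Ω M N) = rightStar Ω M * rightStar Ω N :=
    Function.rightInverse_invFun (rightStar_bijective hΩ).2 _
  rw [← h, (rightStar_bijective hΩ).1.eq_iff, eq_comm]

/-- Blades: the scalars, and the products `v₁ ∧ ⋯ ∧ v_p`. -/
def IsBlade (B : ExteriorAlgebra 𝕜 X) : Prop :=
  (∃ c : 𝕜, B = algebraMap 𝕜 (ExteriorAlgebra 𝕜 X) c) ∨
    ∃ (p : ℕ) (v : Fin p → X), B = ιMulti 𝕜 p v

/-- The space `[B]` of a blade: `span (v₁, …, v_p)` if `0 ≠ B = v₁ ∧ ⋯ ∧ v_p` (see `bladeSpace_ιMulti`), and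
`{0}` if `B` is a scalar, in particular if `B = 0` (see `bladeSpace_algebraMap`). All the spans in the
supremum are equal. -/
def bladeSpace (B : ExteriorAlgebra 𝕜 X) : Submodule 𝕜 X :=
  ⨆ (p : ℕ) (v : Fin p → X) (_ : B ≠ 0 ∧ B = ιMulti 𝕜 p v), Submodule.span 𝕜 (Set.range v)

theorem ιMulti_ne_zero_iff {p : ℕ} (v : Fin p → X) :
    ιMulti 𝕜 p v ≠ 0 ↔ LinearIndependent 𝕜 v := by
  refine ⟨fun h => by_contra fun h' => h ((ιMulti 𝕜 p).map_linearDependent v h'), fun h => ?_⟩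
  set s : Set.powersetCard (Fin p) p := Set.powersetCard.ofCard (s := Finset.univ) (by simp)
  have h1 := (exteriorPower.ιMulti_family_linearIndependent_field (n := p) h).ne_zero s
  have hs : ⇑(Set.powersetCard.ofFinEmbEquiv.symm s) = id := by
    refine StrictMono.range_inj (OrderEmbedding.strictMono _) strictMono_id |>.mp ?_
    ext i
    rw [Set.powersetCard.mem_range_ofFinEmbEquiv_symm_iff_mem]
    exact ⟨fun _ => ⟨i, rfl⟩, fun _ => Finset.mem_univ i⟩
  intro h0
  apply h1
  rw [exteriorPower.ιMulti_family, hs]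
  exact Subtype.ext h0

theorem span_le_of_ιMulti_eq {p q : ℕ} (v : Fin p → X) (w : Fin q → X)
    (h0 : ιMulti 𝕜 p v ≠ 0) (h : ιMulti 𝕜 p v = ιMulti 𝕜 q w) :
    Submodule.span 𝕜 (Set.range w) ≤ Submodule.span 𝕜 (Set.range v) := by
  rw [Submodule.span_le]
  rintro _ ⟨j, rfl⟩
  by_contra hj
  have h1 : LinearIndependent 𝕜 (Fin.cons (w j) v : Fin (p + 1) → X) :=
    LinearIndependent.finCons ((ιMulti_ne_zero_iff v).mp h0) hj
  apply (ιMulti_ne_zero_iff _).mpr h1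
  rw [ιMulti_succ_apply]
  change ι 𝕜 (w j) * ιMulti 𝕜 p v = 0
  rw [h, ιMulti_apply]
  exact ι_mul_prod_list w j

theorem bladeSpace_ιMulti {p : ℕ} (v : Fin p → X) (h0 : ιMulti 𝕜 p v ≠ 0) :
    bladeSpace (ιMulti 𝕜 p v) = Submodule.span 𝕜 (Set.range v) := by
  refine le_antisymm ?_ ?_
  · simp only [bladeSpace, iSup_le_iff]
    exact fun q w h => span_le_of_ιMulti_eq v w h0 h.2
  · exact le_iSup₂_of_le p v (le_iSup_of_le ⟨h0, rfl⟩ le_rfl)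

theorem bladeSpace_algebraMap (c : 𝕜) :
    bladeSpace (algebraMap 𝕜 (ExteriorAlgebra 𝕜 X) c) = ⊥ := by
  rw [eq_bot_iff]
  simp only [bladeSpace, iSup_le_iff]
  rintro (_ | p) v ⟨h0, h⟩
  · simp [Set.range_eq_empty]
  · exfalso
    apply h0
    rw [← inner_self_eq_zero (𝕜 := 𝕜)]
    nth_rw 1 [h]
    rw [Algebra.algebraMap_eq_smul_one, inner_smul_right, ← ιMulti_zero_apply (![] : Fin 0 → X)]
    exact mul_eq_zero_of_right _ (innerForm_ne (by simp) v _)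

/-- Associated principal bases `(e₁, …, e_p)` of `V` and `(f₁, …, f_q)` of `W`, with principal angles
`0 ≤ θ₁ ≤ ⋯ ≤ θ_m ≤ π/2`, `m = min p q`. If `V` or `W` is `{0}`, these are any orthonormal bases. -/
structure IsPrincipalBases (V W : Submodule 𝕜 X) {p q : ℕ} (e : Fin p → X) (f : Fin q → X) :
    Prop where
  orthonormal_left : Orthonormal 𝕜 e
  span_left : Submodule.span 𝕜 (Set.range e) = V
  orthonormal_right : Orthonormal 𝕜 f
  span_right : Submodule.span 𝕜 (Set.range f) = W
  inner_eq_zero : ∀ (i : Fin p) (j : Fin q), (i : ℕ) ≠ (j : ℕ) → inner 𝕜 (e i) (f j) = 0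
  principal_angles : ∃ θ : Fin (min p q) → ℝ, Monotone θ ∧
    (∀ i, θ i ∈ Set.Icc 0 (Real.pi / 2)) ∧
    ∀ i, inner 𝕜 (e (Fin.castLE (min_le_left p q) i)) (f (Fin.castLE (min_le_right p q) i)) =
      (Real.cos (θ i) : 𝕜)

/-- `B = B_P ∧ B_⊥` is a projective-orthogonal factorization of `B` with respect to `A`:
`B_P = ε ‖B‖ f₁ ∧ ⋯ ∧ f_m` and `B_⊥ = f_{m+1} ∧ ⋯ ∧ f_q`, where `(f₁, …, f_q)` is a principal basis of
`[B]` with respect to `[A]`, `m = min p q` and `ε` is a unit scalar. -/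
def IsPOFactorization (A B BP Bperp : ExteriorAlgebra 𝕜 X) : Prop :=
  ∃ (p q : ℕ) (e : Fin p → X) (f : Fin q → X) (ε : 𝕜),
    IsPrincipalBases (bladeSpace A) (bladeSpace B) e f ∧ ‖ε‖ = 1 ∧
    BP = (ε * (‖B‖ : 𝕜)) • ιMulti 𝕜 (min p q) (fun i => f (Fin.castLE (min_le_right p q) i)) ∧
    Bperp = ιMulti 𝕜 (q - min p q)
      (fun i => f ⟨min p q + i, by have := i.isLt; omega⟩) ∧
    B = BP * Bperp

/-- `Θ` is an asymmetric angle of `V = [A]` with `W = [B]`, computed from some nonzero blades `A`, `B` and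
some projective-orthogonal factorization `B = B_P ∧ B_⊥` with respect to `A`. -/
def IsAsymmetricAngle (V W : Submodule 𝕜 X) (Θ : ℝ) : Prop :=
  ∃ A B BP Bperp : ExteriorAlgebra 𝕜 X,
    IsBlade A ∧ A ≠ 0 ∧ bladeSpace A = V ∧ IsBlade B ∧ B ≠ 0 ∧ bladeSpace B = W ∧
    IsPOFactorization A B BP Bperp ∧ Θ = Real.arccos (‖inner 𝕜 A BP‖ / (‖A‖ * ‖B‖))

open Classical in
/-- The asymmetric angle `Θ_{V,W}`: the angle above, which does not depend on the choices. -/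
def asymmetricAngle (V W : Submodule 𝕜 X) : ℝ :=
  if h : ∃! Θ : ℝ, IsAsymmetricAngle V W Θ then h.choose else 0

end Grassmann
end

noncomputable section

namespace Grassmann

open ExteriorAlgebra

variable {𝕜 : Type*} [RCLike 𝕜] {X : Type*} [NormedAddCommGroup X] [InnerProductSpace 𝕜 X]

/-! ### Products of vectors -/

/-! The star sends each product of vectors of an orthonormal basis to a unit scalar times the
product of the complementary vectors, so it is an isometry (`norm_rightStar`) and `‖A ∨ B‖ = ‖A^⋆ ∧
B^⋆‖`. For nonzero blades, `A^⋆` has norm `‖A‖` and is a multiple of the product of any orthonormal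
basis of `[A]ᗮ` (`IsBlade.exists_rightStar_eq_smul`); likewise for `B`.

So let `e` and `f` be principal bases of `[A]ᗮ` and `W = [B]`, and let `g` be an orthonormal basis
of `Wᗮ`. It remains to compute `‖e₁ ∧ ⋯ ∧ e_p ∧ g₁ ∧ ⋯ ∧ g_k‖` (`norm_ιMulti_mul_eq_norm_inner`).
Wedging with the `g_j` kills `Wᗮ`, so each `e_i` may be replaced by its projection `cos θ_i f_i` on
`W`, or by `0` when `i > q`. The norm is therefore the product of the cosines if `p ≤ q` and `0`
otherwise, which is also `|⟪e₁ ∧ ⋯ ∧ e_p, f₁ ∧ ⋯ ∧ f_m⟫|`, the cosine of the asymmetric angle.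

The angle is specified by unique existence. Existence comes from principal bases, obtained by
singular value decomposition of the projection of `V` to `W`. Uniqueness is a by-product: the
formula holds for every admissible angle, so it determines the cosine. -/

theorem ιMulti_comp_cast {m n : ℕ} (h : m = n) (v : Fin n → X) :
    ιMulti 𝕜 m (fun i => v (Fin.cast h i)) = ιMulti 𝕜 n v := by
  subst h
  rfl

/-- If the vectors `v i` lie in the span of a linearly independent family `w` of the same length, then
`v₁ ∧ ⋯ ∧ v_p` is a multiple of `w₁ ∧ ⋯ ∧ w_p`. -/
theorem exists_ιMulti_eq_smul {p : ℕ} (v w : Fin p → X) (hw : LinearIndependent 𝕜 w)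
    (hv : ∀ i, v i ∈ Submodule.span 𝕜 (Set.range w)) :
    ∃ c : 𝕜, ιMulti 𝕜 p v = c • ιMulti 𝕜 p w := by
  let b := Module.Basis.span hw
  let g : Submodule.span 𝕜 (Set.range w) [⋀^Fin p]→ₗ[𝕜] ExteriorAlgebra 𝕜 X :=
    (ιMulti 𝕜 p).compLinearMap (Submodule.subtype _)
  -- An alternating map in as many arguments as the dimension is its value on a basis times the
  -- determinant.
  have hg : g = (LinearMap.toSpanSingleton 𝕜 _ (g b)).compAlternatingMap b.det := by
    refine Module.Basis.ext_alternating b fun i hi => ?_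
    let σ : Equiv.Perm (Fin p) := Equiv.ofBijective i (Finite.injective_iff_bijective.1 hi)
    change g (b ∘ σ) = ((LinearMap.toSpanSingleton 𝕜 _ (g b)).compAlternatingMap b.det) (b ∘ σ)
    simp [AlternatingMap.map_perm, Module.Basis.det_self]
  have hgb : g b = ιMulti 𝕜 p w := by
    change ιMulti 𝕜 p (fun i => (b i : X)) = _
    congr 1
    ext i
    exact congrArg Subtype.val (Module.Basis.span_apply hw i)
  refine ⟨b.det fun i => ⟨v i, hv i⟩, ?_⟩
  have h := congrArg (fun φ => φ fun i => (⟨v i, hv i⟩ : Submodule.span 𝕜 (Set.range w))) hg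
  simp only [hgb, LinearMap.compAlternatingMap_apply, LinearMap.toSpanSingleton_apply] at h
  exact h

/-- Moving `x` past the factors `w i` only changes signs, until it meets `D`. -/
theorem ι_mul_ιMulti_mul_eq_zero {p : ℕ} (x : X) (w : Fin p → X) (D : ExteriorAlgebra 𝕜 X)
    (h : ι 𝕜 x * D = 0) : ι 𝕜 x * (ιMulti 𝕜 p w * D) = 0 := by
  induction p with
  | zero => simpa using h
  | succ p ih =>
    have hs : ι 𝕜 x * ι 𝕜 (w 0) = -(ι 𝕜 (w 0) * ι 𝕜 x) :=
      eq_neg_of_add_eq_zero_left (ι_add_mul_swap x (w 0))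
    rw [ιMulti_succ_apply, mul_assoc, ← mul_assoc (ι 𝕜 x), hs, neg_mul, mul_assoc, ih, mul_zero,
      neg_zero]

/-- Allows each factor to be changed modulo the vectors annihilated by `D`. With `D` the product of
a basis of `Wᗮ`, vectors may be replaced by their projections on `W`. -/
theorem ιMulti_mul_congr {p : ℕ} (v w : Fin p → X) (D : ExteriorAlgebra 𝕜 X)
    (h : ∀ i, ι 𝕜 (v i - w i) * D = 0) : ιMulti 𝕜 p v * D = ιMulti 𝕜 p w * D := by
  induction p with
  | zero => simp
  | succ p ih =>
    rw [ιMulti_succ_apply, ιMulti_succ_apply, mul_assoc, mul_assoc,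
      ih (Matrix.vecTail v) (Matrix.vecTail w) fun i => h i.succ, ← sub_eq_zero, ← sub_mul, ← map_sub]
    exact ι_mul_ιMulti_mul_eq_zero _ _ _ (h 0)

theorem ι_mul_ιMulti_eq_zero {p : ℕ} (x : X) (v : Fin p → X)
    (hx : x ∈ Submodule.span 𝕜 (Set.range v)) : ι 𝕜 x * ιMulti 𝕜 p v = 0 := by
  induction hx using Submodule.span_induction with
  | mem x hx =>
    obtain ⟨i, rfl⟩ := hx
    rw [ιMulti_apply]
    exact ι_mul_prod_list v i
  | zero => simp
  | add x y _ _ hx hy => rw [map_add, add_mul, hx, hy, add_zero]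
  | smul c x _ hx => rw [map_smul, smul_mul_assoc, hx, smul_zero]

/-! ### Orthonormal families -/

theorem span_range_coe_orthonormalBasis {J : Type*} [Fintype J] {V : Submodule 𝕜 X}
    (b : OrthonormalBasis J 𝕜 V) : Submodule.span 𝕜 (Set.range fun i => (b i : X)) = V := by
  have h := congrArg (Submodule.map V.subtype) b.toBasis.span_eq
  rw [Submodule.map_span, Submodule.map_top, Submodule.range_subtype, ← Set.range_comp] at h
  simpa [Function.comp_def] using h

theorem orthonormal_sumElim {J K : Type*} {v : J → X} {g : K → X} {V : Submodule 𝕜 X}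
    (hv : Orthonormal 𝕜 v) (hg : Orthonormal 𝕜 g) (hvV : ∀ j, v j ∈ V) (hgV : ∀ k, g k ∈ Vᗮ) :
    Orthonormal 𝕜 (Sum.elim v g) := by
  refine ⟨?_, ?_⟩
  · rintro (i | i)
    exacts [hv.1 i, hg.1 i]
  · rintro (i | i) (j | j) hij
    · exact hv.2 fun h => hij (h ▸ rfl)
    · exact Submodule.inner_right_of_mem_orthogonal (hvV i) (hgV j)
    · exact Submodule.inner_left_of_mem_orthogonal (hvV j) (hgV i)
    · exact hg.2 fun h => hij (h ▸ rfl)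

theorem orthonormal_finAppend {m n : ℕ} {v : Fin m → X} {g : Fin n → X} {V : Submodule 𝕜 X}
    (hv : Orthonormal 𝕜 v) (hg : Orthonormal 𝕜 g) (hvV : ∀ j, v j ∈ V) (hgV : ∀ k, g k ∈ Vᗮ) :
    Orthonormal 𝕜 (Fin.append v g) := by
  have h := (orthonormal_sumElim hv hg hvV hgV).comp _ (finSumFinEquiv (m := m) (n := n)).symm.injective
  convert! h using 1
  ext i
  refine Fin.addCases (fun i => ?_) (fun i => ?_) i <;> simp

theorem isBlade_exteriorBasis {I : Type*} [Fintype I] [LinearOrder I]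
    (b : OrthonormalBasis I 𝕜 X) (s : Finset I) : IsBlade (b.toBasis.ExteriorAlgebra s) :=
  Or.inr ⟨_, _, ExteriorAlgebra.basis_apply b.toBasis s⟩

variable [FiniteDimensional 𝕜 X]

/-! ### Blades -/

theorem inner_ιMulti_of_ne {p q : ℕ} (h : p ≠ q) (v : Fin p → X) (w : Fin q → X) :
    inner 𝕜 (ιMulti 𝕜 p v) (ιMulti 𝕜 q w) = 0 :=
  innerForm_ne h v w

theorem norm_ιMulti_of_orthonormal {p : ℕ} {v : Fin p → X} (hv : Orthonormal 𝕜 v) :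
    ‖ιMulti 𝕜 p v‖ = 1 := by
  have h : inner 𝕜 (ιMulti 𝕜 p v) (ιMulti 𝕜 p v) = (1 : 𝕜) := by
    rw [inner_ιMulti, ← Matrix.det_one (n := Fin p)]
    congr 1
    ext i j
    simp [Matrix.one_apply, orthonormal_iff_ite.mp hv]
  rw [inner_self_eq_norm_sq_to_K] at h
  have h' : ‖ιMulti 𝕜 p v‖ ^ 2 = 1 := by exact_mod_cast h
  exact (pow_eq_one_iff_of_nonneg (norm_nonneg _) two_ne_zero).mp h'

theorem ιMulti_ne_zero_of_orthonormal {p : ℕ} {v : Fin p → X} (hv : Orthonormal 𝕜 v) :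
    ιMulti 𝕜 p v ≠ 0 :=
  (ιMulti_ne_zero_iff v).mpr hv.linearIndependent

/-- A nonzero blade is, up to a scalar of modulus its norm, the product of any orthonormal basis of its
space. -/
theorem IsBlade.exists_eq_smul_ιMulti {A : ExteriorAlgebra 𝕜 X} (hA : IsBlade A) (h0 : A ≠ 0)
    {p : ℕ} {v : Fin p → X} (hv : Orthonormal 𝕜 v)
    (hs : Submodule.span 𝕜 (Set.range v) = bladeSpace A) :
    ∃ c : 𝕜, ‖c‖ = ‖A‖ ∧ A = c • ιMulti 𝕜 p v := by
  suffices h : ∃ c : 𝕜, A = c • ιMulti 𝕜 p v by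
    obtain ⟨c, hc⟩ := h
    exact ⟨c, by rw [hc, norm_smul, norm_ιMulti_of_orthonormal hv, mul_one], hc⟩
  have hp := finrank_span_eq_card hv.linearIndependent
  rw [hs, Fintype.card_fin] at hp
  rcases hA with ⟨c, rfl⟩ | ⟨k, w, rfl⟩
  -- A scalar has space `{0}`, so the orthonormal basis is empty and its product is `1`.
  · rw [bladeSpace_algebraMap, finrank_bot] at hp
    subst hp
    exact ⟨c, by rw [ιMulti_zero_apply, Algebra.algebraMap_eq_smul_one]⟩
  · have hw := (ιMulti_ne_zero_iff w).mp h0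
    rw [bladeSpace_ιMulti w h0] at hs hp
    rw [finrank_span_eq_card hw, Fintype.card_fin] at hp
    subst hp
    exact exists_ιMulti_eq_smul w v hv.linearIndependent fun i =>
      hs ▸ Submodule.subset_span ⟨i, rfl⟩

/-! ### The star in an orthonormal basis -/

section Star

variable {I : Type*} [Fintype I] [LinearOrder I] (b : OrthonormalBasis I 𝕜 X)

theorem inner_exteriorBasis (s t : Finset I) :
    inner 𝕜 (b.toBasis.ExteriorAlgebra s) (b.toBasis.ExteriorAlgebra t) =
      if s = t then (1 : 𝕜) else 0 :=
  innerForm_basis b s t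

theorem orthonormal_exteriorBasis : Orthonormal 𝕜 b.toBasis.ExteriorAlgebra := by
  classical
  rw [orthonormal_iff_ite]
  intro s t
  rw [inner_exteriorBasis]

/-- `Ω` is a combination of products of `n` vectors, and distinct grades are orthogonal. An
arbitrary orthonormal basis is allowed because one adapted to a given blade is needed later. -/
theorem inner_exteriorBasis_orientation {Ω : ExteriorAlgebra 𝕜 X} (hΩ : IsOrientation Ω)
    (s : Finset I) (hs : s ≠ Finset.univ) : inner 𝕜 (b.toBasis.ExteriorAlgebra s) Ω = 0 := by
  have hc : s.card ≠ Module.finrank 𝕜 X := by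
    rw [Module.finrank_eq_card_basis b.toBasis]
    exact fun h => hs ((Finset.card_eq_iff_eq_univ s).mp h)
  have h := hΩ.mem
  clear hΩ
  rw [← ExteriorAlgebra.ιMulti_span_fixedDegree] at h
  induction h using Submodule.span_induction with
  | mem x hx =>
    obtain ⟨w, rfl⟩ := hx
    rw [ExteriorAlgebra.basis_apply]
    exact innerForm_ne hc _ w
  | zero => simp
  | add x y _ _ hx hy => rw [inner_add_right, hx, hy, add_zero]
  | smul c x _ hx => rw [inner_smul_right, hx, mul_zero]

/-- The full product is the only basis element not orthogonal to `Ω`, so its coefficient carries the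
whole norm of `Ω`. -/
theorem norm_inner_exteriorBasis_univ_orientation {Ω : ExteriorAlgebra 𝕜 X}
    (hΩ : IsOrientation Ω) : ‖inner 𝕜 (b.toBasis.ExteriorAlgebra Finset.univ) Ω‖ = 1 := by
  have h : Ω = inner 𝕜 (b.toBasis.ExteriorAlgebra Finset.univ) Ω •
      b.toBasis.ExteriorAlgebra Finset.univ := by
    refine InnerProductSpace.ext_inner_left_basis (𝕜 := 𝕜) b.toBasis.ExteriorAlgebra fun s => ?_
    rw [inner_smul_right, inner_exteriorBasis]
    split_ifs with hs
    · rw [hs, mul_one]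
    · rw [inner_exteriorBasis_orientation b hΩ s hs, mul_zero]
  have h' := hΩ.norm_eq_one
  rwa [h, norm_smul, (orthonormal_exteriorBasis b).1, mul_one] at h'

/-- The star permutes the basis products up to complementation and unit scalars. -/
theorem exists_rightStar_exteriorBasis {Ω : ExteriorAlgebra 𝕜 X} (hΩ : IsOrientation Ω)
    (s : Finset I) : ∃ u : 𝕜, ‖u‖ = 1 ∧
      rightStar Ω (b.toBasis.ExteriorAlgebra s) = u • b.toBasis.ExteriorAlgebra sᶜ := by
  refine ⟨inner 𝕜 (b.toBasis.ExteriorAlgebra s * b.toBasis.ExteriorAlgebra sᶜ) Ω, ?_, ?_⟩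
  · have hd : Disjoint s sᶜ := disjoint_compl_right
    have hu : ‖inner 𝕜 (b.toBasis.ExteriorAlgebra (s.disjUnion sᶜ hd)) Ω‖ = 1 := by
      rw [Finset.disjUnion_eq_union, Finset.union_compl]
      exact norm_inner_exteriorBasis_univ_orientation b hΩ
    rcases basis_mul_disjoint b.toBasis s sᶜ hd with h1 | h1 <;> rw [h1]
    · exact hu
    · rw [inner_neg_left, norm_neg, hu]
  · refine InnerProductSpace.ext_inner_left_basis (𝕜 := 𝕜) b.toBasis.ExteriorAlgebra fun t => ?_
    rw [rightStar, inner_leftContraction, inner_smul_right, inner_exteriorBasis]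
    split_ifs with ht
    · rw [ht, mul_one]
    rw [mul_zero]
    -- The coefficient at `t` is `⟪E_s ∧ E_t, Ω⟫`. It vanishes if `s` and `t` are disjoint without
    -- filling the index set, by grade, and if they overlap, by a repeated factor.
    by_cases hd : Disjoint s t
    · have hne : s.disjUnion t hd ≠ Finset.univ := fun e =>
        ht (IsCompl.compl_eq ⟨hd, codisjoint_iff.mpr (by
          rw [Finset.disjUnion_eq_union] at e; exact e)⟩).symm
      have hu := inner_exteriorBasis_orientation b hΩ _ hne
      rcases basis_mul_disjoint b.toBasis s t hd with h1 | h1 <;> rw [h1]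
      · exact hu
      · rw [inner_neg_left, hu, neg_zero]
    · have := ExteriorAlgebra.basis_mul_of_not_disjoint b.toBasis
        (Set.powersetCard.ofCard (s := s) rfl) (Set.powersetCard.ofCard (s := t) rfl) hd
      simp only [Set.powersetCard.val_ofCard] at this
      rw [this, inner_zero_left]

theorem bladeSpace_exteriorBasis (s : Finset I) :
    bladeSpace (b.toBasis.ExteriorAlgebra s) = Submodule.span 𝕜 (b '' s) := by
  have h0 : b.toBasis.ExteriorAlgebra s ≠ 0 := Module.Basis.ne_zero _ s
  rw [ExteriorAlgebra.basis_apply] at h0 ⊢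
  refine (bladeSpace_ιMulti _ h0).trans ?_
  congr 1
  ext x
  constructor
  · rintro ⟨i, rfl⟩
    refine ⟨_, ?_, (congrFun b.coe_toBasis _).symm⟩
    exact (Set.powersetCard.mem_range_ofFinEmbEquiv_symm_iff_mem _ _).mp ⟨i, rfl⟩
  · rintro ⟨i, hi, rfl⟩
    obtain ⟨j, rfl⟩ := (Set.powersetCard.mem_range_ofFinEmbEquiv_symm_iff_mem
      (Set.powersetCard.ofCard (s := s) rfl) i).mpr hi
    exact ⟨j, congrFun b.coe_toBasis _⟩

end Star

/-! ### The star as a conjugate-linear isometry -/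

theorem rightStar_smul (Ω : ExteriorAlgebra 𝕜 X) (c : 𝕜) (M : ExteriorAlgebra 𝕜 X) :
    rightStar Ω (c • M) = star c • rightStar Ω M :=
  ext_inner_left 𝕜 fun L => by
    rw [rightStar, inner_leftContraction, smul_mul_assoc, inner_smul_left, inner_smul_right,
      rightStar, inner_leftContraction]
    rfl

theorem rightStar_zero (Ω : ExteriorAlgebra 𝕜 X) : rightStar Ω 0 = 0 := by
  simpa using rightStar_smul Ω 0 0

theorem rightStar_sum {J : Type*} (Ω : ExteriorAlgebra 𝕜 X) (s : Finset J)
    (M : J → ExteriorAlgebra 𝕜 X) : rightStar Ω (∑ j ∈ s, M j) = ∑ j ∈ s, rightStar Ω (M j) :=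
  ext_inner_left 𝕜 fun L => by
    simp only [rightStar, inner_leftContraction, Finset.sum_mul, sum_inner, inner_sum]

/-- The star is isometric. -/
theorem norm_rightStar {Ω : ExteriorAlgebra 𝕜 X} (hΩ : IsOrientation Ω)
    (M : ExteriorAlgebra 𝕜 X) : ‖rightStar Ω M‖ = ‖M‖ := by
  let b := stdOrthonormalBasis 𝕜 X
  let E := b.toBasis.ExteriorAlgebra
  choose u hu hE using exists_rightStar_exteriorBasis b hΩ
  have hO : Orthonormal 𝕜 E := orthonormal_exteriorBasis b
  -- The images of the basis products are again orthonormal, since complementation is injective. The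
  -- star conjugates coefficients, which preserves their moduli.
  have hO' : Orthonormal 𝕜 fun s => u s • E sᶜ := by
    refine ⟨fun s => by rw [norm_smul, hu, hO.1, mul_one], fun s t hst => ?_⟩
    change inner 𝕜 (u s • E sᶜ) (u t • E tᶜ) = 0
    rw [inner_smul_left, inner_smul_right, hO.2 (compl_injective.ne hst), mul_zero, mul_zero]
  have h1 : M = ∑ s, E.repr M s • E s := (E.sum_repr M).symm
  have h2 : rightStar Ω M = ∑ s, star (E.repr M s) • (u s • E sᶜ) := by
    conv_lhs => rw [h1]
    rw [rightStar_sum]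
    exact Finset.sum_congr rfl fun s _ => by rw [rightStar_smul, hE]
  have h3 : inner 𝕜 (rightStar Ω M) (rightStar Ω M) = inner 𝕜 M M := by
    rw [h2, hO'.inner_sum]
    conv_rhs => rw [h1]
    rw [hO.inner_sum]
    exact Finset.sum_congr rfl fun s _ => by simp [mul_comm]
  rw [inner_self_eq_norm_sq_to_K, inner_self_eq_norm_sq_to_K] at h3
  exact (pow_left_inj₀ (norm_nonneg _) (norm_nonneg _) two_ne_zero).mp (by exact_mod_cast h3)

theorem norm_regressive {Ω : ExteriorAlgebra 𝕜 X} (hΩ : IsOrientation Ω)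
    (M N : ExteriorAlgebra 𝕜 X) : ‖regressive Ω M N‖ = ‖rightStar Ω M * rightStar Ω N‖ := by
  rw [← norm_rightStar hΩ, (regressive_eq_iff hΩ M N _).mp rfl]

theorem exists_orthonormal_span_eq (V : Submodule 𝕜 X) :
    ∃ (k : ℕ) (v : Fin k → X), Orthonormal 𝕜 v ∧ Submodule.span 𝕜 (Set.range v) = V := by
  refine ⟨_, fun i => (stdOrthonormalBasis 𝕜 V i : X),
    (stdOrthonormalBasis 𝕜 V).orthonormal.comp_linearIsometry V.subtypeₗᵢ,
    span_range_coe_orthonormalBasis _⟩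

/-- The star of a nonzero blade `A` is, up to a scalar of modulus `‖A‖`, the product of any orthonormal
basis of `[A]ᗮ`. -/
theorem IsBlade.exists_rightStar_eq_smul {Ω : ExteriorAlgebra 𝕜 X} (hΩ : IsOrientation Ω)
    {A : ExteriorAlgebra 𝕜 X} (hA : IsBlade A) (h0 : A ≠ 0) {k : ℕ} {g : Fin k → X}
    (hg : Orthonormal 𝕜 g) (hs : Submodule.span 𝕜 (Set.range g) = (bladeSpace A)ᗮ) :
    ∃ c : 𝕜, ‖c‖ = ‖A‖ ∧ rightStar Ω A = c • ιMulti 𝕜 k g := by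
  obtain ⟨a, v, hv, hvs⟩ := exists_orthonormal_span_eq (bladeSpace A)
  -- Bases of `[A]` and `[A]ᗮ` are joined into a basis of `X`, so that `A` is a multiple of the
  -- basis product over the first `a` indices.
  have hw : Orthonormal 𝕜 (Fin.append v g) := orthonormal_finAppend (V := bladeSpace A) hv hg
    (fun j => hvs ▸ Submodule.subset_span ⟨j, rfl⟩) (fun j => hs ▸ Submodule.subset_span ⟨j, rfl⟩)
  have hws : ⊤ ≤ Submodule.span 𝕜 (Set.range (Fin.append v g)) := by
    rw [← Submodule.sup_orthogonal_of_hasOrthogonalProjection (K := bladeSpace A), ← hs, ← hvs,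
      ← Submodule.span_union]
    refine Submodule.span_mono (Set.union_subset ?_ ?_)
    · rintro _ ⟨i, rfl⟩
      exact ⟨Fin.castAdd k i, Fin.append_left v g i⟩
    · rintro _ ⟨i, rfl⟩
      exact ⟨Fin.natAdd a i, Fin.append_right v g i⟩
  let b : OrthonormalBasis (Fin (a + k)) 𝕜 X := OrthonormalBasis.mk hw hws
  have hbw : ⇑b = Fin.append v g := OrthonormalBasis.coe_mk hw hws
  let s : Finset (Fin (a + k)) := Finset.univ.image (Fin.castAdd k)
  have hsc : ∀ i, Fin.natAdd a i ∈ sᶜ := fun i => by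
    simp only [s, Finset.mem_compl, Finset.mem_image, not_exists]
    intro j hj
    have := congrArg Fin.val hj.2
    simp only [Fin.val_castAdd, Fin.val_natAdd] at this
    omega
  have hbs : b '' s = Set.range v := by
    rw [hbw]
    ext x
    simp [s]
  have hbsc : b '' ↑(sᶜ) = Set.range g := by
    rw [hbw]
    ext x
    constructor
    · rintro ⟨i, hi, rfl⟩
      induction i using Fin.addCases with
      | left i =>
        exact absurd (Finset.mem_image_of_mem _ (Finset.mem_univ i)) (Finset.mem_compl.mp hi)
      | right i => exact ⟨i, (Fin.append_right v g i).symm⟩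
    · rintro ⟨i, rfl⟩
      exact ⟨Fin.natAdd a i, hsc i, Fin.append_right v g i⟩
  obtain ⟨α, hα, hAα⟩ := hA.exists_eq_smul_ιMulti h0 hv hvs
  -- Comparing blades through their spaces determines them up to a scalar of known modulus, which
  -- avoids tracking the order of the factors.
  obtain ⟨β, hβ, hsβ⟩ := (isBlade_exteriorBasis b s).exists_eq_smul_ιMulti
    (Module.Basis.ne_zero _ s) hv (by rw [bladeSpace_exteriorBasis, hbs])
  obtain ⟨γ, hγ, hscγ⟩ := (isBlade_exteriorBasis b sᶜ).exists_eq_smul_ιMulti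
    (Module.Basis.ne_zero _ sᶜ) hg (by rw [bladeSpace_exteriorBasis, hbsc])
  obtain ⟨u, hu, hsu⟩ := exists_rightStar_exteriorBasis b hΩ s
  rw [(orthonormal_exteriorBasis b).1] at hβ hγ
  have hβ0 : β ≠ 0 := norm_ne_zero_iff.mp (by rw [hβ]; exact one_ne_zero)
  have hA' : A = (α * β⁻¹) • b.toBasis.ExteriorAlgebra s := by
    rw [hsβ, smul_smul, mul_assoc, inv_mul_cancel₀ hβ0, mul_one, hAα]
  refine ⟨star (α * β⁻¹) * u * γ, ?_, ?_⟩
  · simp [hu, hγ, hβ, hα]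
  · conv_lhs => rw [hA']
    rw [rightStar_smul, hsu, hscγ, smul_smul, smul_smul]

/-! ### The asymmetric angle -/

/-- Modulo `Wᗮ`, which the product of the `g j` annihilates, `e i` equals `⟪f i, e i⟫ • f i`. Since
`f` and `g` together are orthonormal, only these scalars contribute to the norm, and they are, up to
conjugation, the diagonal of the Gram matrix on the right. -/
theorem norm_ιMulti_mul_eq_norm_inner {V W : Submodule 𝕜 X} {p q k : ℕ} {e : Fin p → X}
    {f : Fin q → X} (h : IsPrincipalBases V W e f) {g : Fin k → X} (hg : Orthonormal 𝕜 g)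
    (hs : Submodule.span 𝕜 (Set.range g) = Wᗮ) :
    ‖ιMulti 𝕜 p e * ιMulti 𝕜 k g‖ =
      ‖inner 𝕜 (ιMulti 𝕜 p e)
        (ιMulti 𝕜 (min p q) fun i => f (Fin.castLE (min_le_right p q) i))‖ := by
  have hfW : ∀ j, f j ∈ W := fun j => h.span_right ▸ Submodule.subset_span ⟨j, rfl⟩
  have hgW : ∀ j, g j ∈ Wᗮ := fun j => hs ▸ Submodule.subset_span ⟨j, rfl⟩
  have hker : ∀ x : X, (∀ j, inner 𝕜 (f j) x = 0) → ι 𝕜 x * ιMulti 𝕜 k g = 0 := by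
    intro x hx
    refine ι_mul_ιMulti_eq_zero x g ?_
    rw [hs, ← h.span_right, Submodule.mem_orthogonal]
    intro y hy
    induction hy using Submodule.span_induction with
    | mem y hy => obtain ⟨j, rfl⟩ := hy; exact hx j
    | zero => simp
    | add y z _ _ hy hz => rw [inner_add_left, hy, hz, add_zero]
    | smul c y _ hy => rw [inner_smul_left, hy, mul_zero]
  rcases le_or_gt p q with hpq | hpq
  · have hff : Orthonormal 𝕜 fun i : Fin p => f (Fin.castLE hpq i) :=
      h.orthonormal_right.comp _ (Fin.castLE_injective hpq)
    have h1 : ιMulti 𝕜 p e * ιMulti 𝕜 k g =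
        (∏ i : Fin p, inner 𝕜 (f (Fin.castLE hpq i)) (e i)) •
          (ιMulti 𝕜 p (fun i => f (Fin.castLE hpq i)) * ιMulti 𝕜 k g) := by
      rw [← smul_mul_assoc, ← (ιMulti 𝕜 p).map_smul_univ]
      refine ιMulti_mul_congr _ _ _ fun i => hker _ fun j => ?_
      rw [inner_sub_right, inner_smul_right, orthonormal_iff_ite.mp h.orthonormal_right]
      split_ifs with hj
      · rw [hj, mul_one, sub_self]
      · rw [mul_zero, sub_zero, inner_eq_zero_symm]
        exact h.inner_eq_zero i j fun hij => hj (Fin.ext hij.symm)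
    have h2 : (ιMulti 𝕜 (min p q) fun i => f (Fin.castLE (min_le_right p q) i)) =
        ιMulti 𝕜 p (fun i => f (Fin.castLE hpq i)) :=
      ιMulti_comp_cast (min_eq_left hpq) fun i => f (Fin.castLE hpq i)
    have h3 : inner 𝕜 (ιMulti 𝕜 p e) (ιMulti 𝕜 p fun i => f (Fin.castLE hpq i)) =
        ∏ i : Fin p, inner 𝕜 (e i) (f (Fin.castLE hpq i)) := by
      rw [inner_ιMulti, ← Matrix.det_diagonal]
      congr 1
      ext i j
      rw [Matrix.diagonal_apply, Matrix.of_apply]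
      split_ifs with hij
      · rw [hij]
      · exact h.inner_eq_zero _ _ fun h' => hij (Fin.ext h')
    rw [h1, h2, h3, norm_smul, ιMulti_mul_ιMulti, norm_ιMulti_of_orthonormal
      (orthonormal_finAppend hff hg (fun j => hfW _) hgW), mul_one, norm_prod, norm_prod]
    exact Finset.prod_congr rfl fun i _ => norm_inner_symm _ _
  -- For `p > q` both sides vanish: the right by grade, the left because the vector of index `q`
  -- (the first without a partner in `f`) lies in `Wᗮ`.
  · rw [inner_ιMulti_of_ne (by omega), norm_zero, norm_eq_zero]
    have h1 : ι 𝕜 (e ⟨q, hpq⟩) * ιMulti 𝕜 k g = 0 := hker _ fun j => by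
      rw [inner_eq_zero_symm]
      exact h.inner_eq_zero _ _ j.isLt.ne'
    rw [ιMulti_mul_congr e (Function.update e ⟨q, hpq⟩ 0), (ιMulti 𝕜 p).map_update_zero, zero_mul]
    intro i
    by_cases hi : i = ⟨q, hpq⟩
    · subst hi
      simpa using h1
    · simp [hi]

/-- Stated for an arbitrary admissible `Θ`, so that it also yields uniqueness of the angle. -/
theorem norm_regressive_of_isAsymmetricAngle {Ω : ExteriorAlgebra 𝕜 X} (hΩ : IsOrientation Ω)
    {A B : ExteriorAlgebra 𝕜 X} (hA : IsBlade A) (hB : IsBlade B) (hA0 : A ≠ 0) (hB0 : B ≠ 0)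
    {Θ : ℝ} (hΘ : IsAsymmetricAngle (bladeSpace A)ᗮ (bladeSpace B) Θ) :
    ‖regressive Ω A B‖ = ‖A‖ * ‖B‖ * Real.cos Θ := by
  obtain ⟨C, D, DP, Dperp, hC, hC0, hCA, hD, hD0, hDB,
    ⟨p, q, e, f, ε, hef, hε, rfl, rfl, -⟩, rfl⟩ := hΘ
  rw [Real.cos_arccos]
  rotate_left
  · exact le_trans (by norm_num) (div_nonneg (norm_nonneg _) (by positivity))
  -- Cauchy–Schwarz, with `‖D_P‖ = ‖D‖`, puts the argument of `arccos` in its proper range.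
  · refine div_le_one_of_le₀ ((norm_inner_le_norm _ _).trans ?_) (by positivity)
    have hf : ‖ιMulti 𝕜 (min p q) fun i => f (Fin.castLE (min_le_right p q) i)‖ = 1 :=
      norm_ιMulti_of_orthonormal
        (hef.orthonormal_right.comp _ (Fin.castLE_injective (min_le_right p q)))
    rw [norm_smul, hf, norm_mul, hε]
    simp
  rw [hCA, hDB] at hef
  obtain ⟨k, g, hg, hgs⟩ := exists_orthonormal_span_eq (bladeSpace B)ᗮ
  obtain ⟨α, hα, hAα⟩ := hA.exists_rightStar_eq_smul hΩ hA0 hef.orthonormal_left hef.span_left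
  obtain ⟨β, hβ, hBβ⟩ := hB.exists_rightStar_eq_smul hΩ hB0 hg hgs
  -- The blade `C` defining the angle is a multiple of the same product of the `e i` as `A^⋆`; the
  -- norms of `C` and `D` then cancel.
  obtain ⟨γ, hγ, hCγ⟩ := hC.exists_eq_smul_ιMulti hC0 hef.orthonormal_left (hef.span_left.trans hCA.symm)
  have hC' := norm_ne_zero_iff.mpr hC0
  have hD' := norm_ne_zero_iff.mpr hD0
  rw [norm_regressive hΩ, hAα, hBβ, smul_mul_smul_comm, norm_smul, norm_mul, hα, hβ,
    norm_ιMulti_mul_eq_norm_inner hef hg hgs, inner_smul_right, norm_mul, norm_mul, hε]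
  conv_rhs => rw [hCγ]
  rw [inner_smul_left, norm_mul, RCLike.norm_conj, ← hCγ, hγ]
  simp only [norm_algebraMap', norm_norm]
  field_simp

/-! ### Existence of principal bases -/

/-- Singular value decomposition of a linear map between finite-dimensional inner product spaces. -/
theorem exists_orthonormalBasis_singularValues {E F : Type*} [NormedAddCommGroup E]
    [InnerProductSpace 𝕜 E] [FiniteDimensional 𝕜 E] [NormedAddCommGroup F] [InnerProductSpace 𝕜 F]
    [FiniteDimensional 𝕜 F] (T : E →ₗ[𝕜] F) :
    ∃ (e : OrthonormalBasis (Fin (Module.finrank 𝕜 E)) 𝕜 E)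
      (f : OrthonormalBasis (Fin (Module.finrank 𝕜 F)) 𝕜 F),
      ∀ i j, inner 𝕜 (T (e i)) (f j) =
        if (i : ℕ) = j then ((T.singularValues i : ℝ) : 𝕜) else 0 := by
  let hS := T.isSymmetric_adjoint_comp_self
  let e := hS.eigenvectorBasis rfl
  have hTe : ∀ i j, inner 𝕜 (T (e i)) (T (e j)) =
      if i = j then ((T.singularValues i : ℝ) : 𝕜) ^ 2 else 0 := by
    intro i j
    rw [← LinearMap.adjoint_inner_right, ← LinearMap.comp_apply, hS.apply_eigenvectorBasis rfl j,
      inner_smul_right, orthonormal_iff_ite.mp e.orthonormal]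
    split_ifs with h
    · rw [← h, mul_one, ← T.sq_singularValues_fin rfl i]
      push_cast
      rfl
    · rw [mul_zero]
  -- The left singular vectors `T e_j / σ_j`. The value `0` past the dimension of `E` is harmless,
  -- because `σ_j = 0` there and only indices with `σ_j ≠ 0` are kept.
  let u : Fin (Module.finrank 𝕜 F) → F := fun j =>
    if h : (j : ℕ) < Module.finrank 𝕜 E then
      ((T.singularValues j : ℝ) : 𝕜)⁻¹ • T (e ⟨j, h⟩) else 0
  let s : Set (Fin (Module.finrank 𝕜 F)) := {j | T.singularValues j ≠ 0}
  have hlt : ∀ j : ℕ, T.singularValues j ≠ 0 → j < Module.finrank 𝕜 E := fun j hj =>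
    lt_of_not_ge fun h => hj (T.singularValues_of_finrank_le h)
  have hu : Orthonormal 𝕜 (s.domRestrict u) := by
    rw [orthonormal_iff_ite]
    rintro ⟨i, hi⟩ ⟨j, hj⟩
    have hi' : ((T.singularValues i : ℝ) : 𝕜) ≠ 0 := by exact_mod_cast hi
    simp only [Set.domRestrict_apply, u, dif_pos (hlt i hi), dif_pos (hlt j hj), inner_smul_left,
      inner_smul_right, hTe, Subtype.mk.injEq, Fin.mk.injEq, Fin.val_inj]
    split_ifs with h
    · subst h
      simp
      field_simp
    · simp
  obtain ⟨f, hf⟩ := hu.exists_orthonormalBasis_extension_of_card_eq (by simp)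
  refine ⟨e, f, fun i j => ?_⟩
  by_cases hi : T.singularValues i = 0
  · have h0 : T (e i) = 0 := by
      rw [← inner_self_eq_zero (𝕜 := 𝕜), hTe, if_pos rfl, hi]
      simp
    rw [h0, inner_zero_left, hi]
    simp
  · have hi' : ((T.singularValues i : ℝ) : 𝕜) ≠ 0 := by exact_mod_cast hi
    have hiF : (i : ℕ) < Module.finrank 𝕜 F := by
      refine lt_of_not_ge fun h => hi ?_
      -- A nonzero `σ_i` has index below the rank of `T`, hence below the dimension of `F`.
      rw [LinearMap.singularValues_eq_zero_iff_le_finrank_range]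
      exact (Submodule.finrank_le _).trans h
    have h1 : T (e i) = ((T.singularValues i : ℝ) : 𝕜) • f ⟨i, hiF⟩ := by
      rw [hf ⟨i, hiF⟩ hi]
      simp [u, smul_smul, hi']
    rw [h1, inner_smul_left, orthonormal_iff_ite.mp f.orthonormal]
    simp [Fin.ext_iff]

/-- Principal bases are singular bases of the orthogonal projection of `V` to `W`, and the cosines
are its singular values. These decrease, so their `arccos` increase. -/
theorem exists_isPrincipalBases (V W : Submodule 𝕜 X) :
    ∃ (p q : ℕ) (e : Fin p → X) (f : Fin q → X), IsPrincipalBases V W e f := by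
  let T : V →ₗ[𝕜] W := W.orthogonalProjectionOnto.toLinearMap ∘ₗ V.subtype
  obtain ⟨e, f, hef⟩ := exists_orthonormalBasis_singularValues T
  have hin : ∀ i j, inner 𝕜 (e i : X) (f j : X) =
      if (i : ℕ) = j then ((T.singularValues i : ℝ) : 𝕜) else 0 := by
    intro i j
    rw [← hef]
    exact (Submodule.inner_orthogonalProjectionOnto_eq_of_mem_right (f j) (e i : X)).symm
  have heo := e.orthonormal.comp_linearIsometry V.subtypeₗᵢ
  have hfo := f.orthonormal.comp_linearIsometry W.subtypeₗᵢ
  refine ⟨_, _, fun i => e i, fun j => f j, heo, span_range_coe_orthonormalBasis e, hfo,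
    span_range_coe_orthonormalBasis f, fun i j hij => by rw [hin, if_neg hij],
    fun i => Real.arccos (T.singularValues i), fun i j hij => ?_, fun i => ?_, fun i => ?_⟩
  · exact Real.arccos_le_arccos (T.singularValues_antitone hij)
  · exact ⟨Real.arccos_nonneg _, Real.arccos_le_pi_div_two.mpr (T.singularValues_nonneg i)⟩
  · have h := hin (Fin.castLE (min_le_left _ _) i) (Fin.castLE (min_le_right _ _) i)
    simp only [Fin.val_castLE, if_true] at h
    -- Needed for `cos` to invert `arccos`: a singular value is an inner product of unit vectors.
    have h1 : T.singularValues i ≤ 1 := by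
      have h2 := norm_inner_le_norm (𝕜 := 𝕜) (e (Fin.castLE (min_le_left _ _) i) : X)
        (f (Fin.castLE (min_le_right _ _) i) : X)
      rw [h, RCLike.norm_ofReal, abs_of_nonneg (T.singularValues_nonneg i)] at h2
      refine h2.trans_eq ?_
      rw [show ‖(e (Fin.castLE (min_le_left _ _) i) : X)‖ = 1 from heo.1 _,
        show ‖(f (Fin.castLE (min_le_right _ _) i) : X)‖ = 1 from hfo.1 _, mul_one]
    rw [h, Real.cos_arccos (by linarith [T.singularValues_nonneg i]) h1]

theorem exists_isAsymmetricAngle (V W : Submodule 𝕜 X) : ∃ Θ : ℝ, IsAsymmetricAngle V W Θ := by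
  obtain ⟨p, q, e, f, h⟩ := exists_isPrincipalBases V W
  have he := ιMulti_ne_zero_of_orthonormal h.orthonormal_left
  have hf := ιMulti_ne_zero_of_orthonormal h.orthonormal_right
  have hV : bladeSpace (ιMulti 𝕜 p e) = V := (bladeSpace_ιMulti e he).trans h.span_left
  have hW : bladeSpace (ιMulti 𝕜 q f) = W := (bladeSpace_ιMulti f hf).trans h.span_right
  refine ⟨_, ιMulti 𝕜 p e, ιMulti 𝕜 q f, _, _, Or.inr ⟨p, e, rfl⟩, he, hV, Or.inr ⟨q, f, rfl⟩, hf,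
    hW, ⟨p, q, e, f, 1, by rwa [hV, hW], norm_one, rfl, rfl, ?_⟩, rfl⟩
  rw [norm_ιMulti_of_orthonormal h.orthonormal_right, RCLike.ofReal_one, mul_one, one_smul,
    ιMulti_mul_ιMulti, ← ιMulti_comp_cast (Nat.add_sub_cancel' (min_le_right p q)) f]
  congr 1
  ext i
  induction i using Fin.addCases with
  | left i => rw [Fin.append_left]; rfl
  | right i => rw [Fin.append_right]; rfl

theorem isAsymmetricAngle_asymmetricAngle {V W : Submodule 𝕜 X}
    (h : ∃! Θ : ℝ, IsAsymmetricAngle V W Θ) : IsAsymmetricAngle V W (asymmetricAngle V W) := by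
  rw [asymmetricAngle, dif_pos h]
  exact h.choose_spec.1

theorem IsAsymmetricAngle.mem_Icc {V W : Submodule 𝕜 X} {Θ : ℝ} (h : IsAsymmetricAngle V W Θ) :
    Θ ∈ Set.Icc 0 Real.pi := by
  obtain ⟨A, B, BP, Bperp, -, -, -, -, -, -, -, rfl⟩ := h
  exact ⟨Real.arccos_nonneg _, Real.arccos_le_pi _⟩

end Grassmann
end

theorem mainTheorem3 {𝕜 : Type*} [RCLike 𝕜] {X : Type*} [NormedAddCommGroup X]
    [InnerProductSpace 𝕜 X] [FiniteDimensional 𝕜 X]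
    (Ω : ExteriorAlgebra 𝕜 X) (hΩ : Grassmann.IsOrientation Ω)
    (A B : ExteriorAlgebra 𝕜 X) (hA : Grassmann.IsBlade A) (hB : Grassmann.IsBlade B) :
    ‖Grassmann.regressive Ω A B‖ =
      ‖A‖ * ‖B‖ * Real.cos (Grassmann.asymmetricAngle
        (Grassmann.bladeSpace A)ᗮ (Grassmann.bladeSpace B)) := by
  by_cases hA0 : A = 0
  · subst hA0
    simp [Grassmann.norm_regressive hΩ, Grassmann.rightStar_zero]
  by_cases hB0 : B = 0
  · subst hB0
    simp [Grassmann.norm_regressive hΩ, Grassmann.rightStar_zero]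
  have key : ∀ {Θ : ℝ}, Grassmann.IsAsymmetricAngle (Grassmann.bladeSpace A)ᗮ
      (Grassmann.bladeSpace B) Θ → ‖Grassmann.regressive Ω A B‖ = ‖A‖ * ‖B‖ * Real.cos Θ :=
    fun h => Grassmann.norm_regressive_of_isAsymmetricAngle hΩ hA hB hA0 hB0 h
  refine key (Grassmann.isAsymmetricAngle_asymmetricAngle ?_)
  obtain ⟨Θ, hΘ⟩ := Grassmann.exists_isAsymmetricAngle (Grassmann.bladeSpace A)ᗮ
    (Grassmann.bladeSpace B)
  -- Both angles satisfy the formula, so their cosines agree, and `cos` is injective on `[0, π]`.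
  refine ⟨Θ, hΘ, fun Θ' hΘ' => Real.injOn_cos hΘ'.mem_Icc hΘ.mem_Icc ?_⟩
  have hne : ‖A‖ * ‖B‖ ≠ 0 := mul_ne_zero (norm_ne_zero_iff.mpr hA0) (norm_ne_zero_iff.mpr hB0)
  exact mul_left_cancel₀ hne ((key hΘ').symm.trans (key hΘ))
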